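/- Let $F$ be a compact connected smooth surface with nonempty boundary and $\chi(F)<0$, and let $M=F\times S^1$, fibred by the circles $\{x\}\times S^1$. Let $g\colon B\looparrowright M$ be a horizontal surface, that is, $B$ is a compact smooth surface with boundary and $g$ is a smooth immersion that is transverse to the circle fibration of $M$ and proper in the sense that $g(B)\cap\partial M=g(\partial B)$. Let $b\in B$ and put $G=\pi_1(M,g(b))$ and $H=g_*(\pi_1(B,b))\le G$. Then $\pi_1(B,b)$ and $G$ are finitely generated, and both the homomorphism $g_*\colon\pi_1(B,b)\to G$ and the inclusion $H\hookrightarrow G$ are quasi-isometric embeddings with respect to the word metrics of arbitrary finite generating sets of $\pi_1(B,b)$, $H$ and $G$. Here a map $f\colon(X,d_X)\to(Y,d_Y)$ is a quasi-isometric embedding if there are constants $L\ge 1$ and $C\ge 0$ such that $\frac1L d_X(x,y)-C\le d_Y(f(x),f(y))\le L\,d_X(x,y)+C$ for all $x,y\in X$. -/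

import Mathlib

open scoped Manifold ContDiff

noncomputable section

/-- The Euler characteristic `χ(X) = ∑ (-1)^i dim H_i(X; ℚ)` of a topological space, computed from
its singular homology with rational coefficients. -/
def eulerCharacteristic.{u} (X : Type u) [TopologicalSpace X] : ℤ :=
  HomologicalComplex.homologyEulerChar
    (((AlgebraicTopology.singularChainComplexFunctor (ModuleCat.{u} ℚ)).obj
      (ModuleCat.of ℚ (ULift.{u} ℚ))).obj (TopCat.of X))

section HorizontalSurface

variable {F B : Type*} [TopologicalSpace F] [ChartedSpace (EuclideanHalfSpace 2) F]
  [TopologicalSpace B] [ChartedSpace (EuclideanHalfSpace 2) B]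

/-- The tangent line at `p` of the circle fibre `{p.1} × S¹` of `F × S¹`. -/
def fibreTangent (p : F × Circle) :
    Submodule ℝ (TangentSpace ((𝓡∂ 2).prod (𝓡 1)) p) :=
  LinearMap.range
    (mfderiv (𝓡 1) ((𝓡∂ 2).prod (𝓡 1)) (fun θ : Circle => ((p.1, θ) : F × Circle)) p.2).toLinearMap

/-- `g : B → F × S¹` is a horizontal surface: a smooth proper immersion that is transverse to the
fibration of `F × S¹` by circles `{x} × S¹`. -/
structure IsHorizontalSurface (g : C(B, F × Circle)) : Prop where
  smooth : ContMDiff (𝓡∂ 2) ((𝓡∂ 2).prod (𝓡 1)) ∞ g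
  immersion : ∀ b : B, Function.Injective (mfderiv (𝓡∂ 2) ((𝓡∂ 2).prod (𝓡 1)) g b)
  transverse : ∀ b : B,
    LinearMap.range (mfderiv (𝓡∂ 2) ((𝓡∂ 2).prod (𝓡 1)) g b).toLinearMap ⊔ fibreTangent (g b) = ⊤
  proper : Set.range g ∩ ((𝓡∂ 2).prod (𝓡 1)).boundary (F × Circle) = g '' (𝓡∂ 2).boundary B

end HorizontalSurface

section WordMetric

variable {G : Type*} [Group G]

/-- The length of a shortest word in the letters `S ∪ S⁻¹` that represents `x`. It is meaningful
when `S` generates `G`. -/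
def wordLength (S : Set G) (x : G) : ℕ :=
  sInf {n | ∃ l : List G, l.length = n ∧ (∀ s ∈ l, s ∈ S ∨ s⁻¹ ∈ S) ∧ l.prod = x}

/-- The word metric on `G` with respect to the generating set `S`. -/
def wordDist (S : Set G) (x y : G) : ℝ := wordLength S (x⁻¹ * y)

end WordMetric

/-- `f` is an `(L, C)`-quasi-isometric embedding from `(X, dX)` to `(Y, dY)` for some constants
`L ≥ 1` and `C ≥ 0`. -/
def IsQuasiIsometricEmbedding {X Y : Type*} (dX : X → X → ℝ) (dY : Y → Y → ℝ) (f : X → Y) : Prop :=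
  ∃ L C : ℝ, 1 ≤ L ∧ 0 ≤ C ∧ ∀ x y : X,
    1 / L * dX x y - C ≤ dY (f x) (f y) ∧ dY (f x) (f y) ≤ L * dX x y + C

end

/-!
The projection `q : B → F` of a horizontal surface is a finite covering, and this forces both maps
to be quasi-isometric embeddings.

Transversality makes the derivative of `q` bijective, and properness makes `q` map boundary points
to boundary points, while interior points go to interior points because the derivative is
surjective. A map between convex bodies with these properties is locally invertible
(`ContDiffWithinAt.exists_injOn_and_nhdsWithin_le_map`): it is injective by the mean value
inequality, and open at interior points by the inverse function theorem. It is also open at a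
boundary point `x`: the interior part of a small half ball around the image of `x` is connected, and
the image of a half ball around `x` is open and closed in it, so covers it. Hence `q` is a local
homeomorphism, and, its source being compact, a covering with finite fibres
(`IsHorizontalSurface.isCoveringMap_fst`).

So `q_* = π ∘ g_*` is injective with image of finite index in `π₁(F)`, where `π : π₁(F × S¹) → π₁(F)`
is induced by the projection. Finite-index subgroups are undistorted, and `π` is Lipschitz, so `g_*`
is bounded below by `q_*`; the upper bound holds for every homomorphism of finitely generated groups
(`isQuasiIsometricEmbedding_of_comp_injective_of_finiteIndex`). The same argument applies to the
inclusion of the image of `g_*`. Finite generation of all groups comes from compactness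
(`fundamentalGroup_fg_of_compactSpace`).
-/

/-! ### Word lengths and finite-index subgroups -/

section WordLength

variable {G K P Q : Type*} [Group G] [Group K] [Group P] [Group Q]

lemma wordLength_list_prod_le {S : Set G} {l : List G} (hl : ∀ s ∈ l, s ∈ S ∨ s⁻¹ ∈ S) :
    wordLength S l.prod ≤ l.length :=
  Nat.sInf_le ⟨l, rfl, hl, rfl⟩

lemma exists_list_length_eq_wordLength {S : Set G} (hS : Subgroup.closure S = ⊤) (x : G) :
    ∃ l : List G, l.length = wordLength S x ∧ (∀ s ∈ l, s ∈ S ∨ s⁻¹ ∈ S) ∧ l.prod = x := by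
  have hx : x ∈ Subgroup.closure S := hS ▸ Subgroup.mem_top x
  rw [← Subgroup.mem_toSubmonoid, Subgroup.closure_toSubmonoid] at hx
  obtain ⟨l, hl, hlx⟩ := Submonoid.exists_list_of_mem_closure hx
  exact Nat.sInf_mem
    (s := {n | ∃ l : List G, l.length = n ∧ (∀ s ∈ l, s ∈ S ∨ s⁻¹ ∈ S) ∧ l.prod = x})
    ⟨l.length, l, rfl, hl, hlx⟩

lemma wordLength_mul_le {S : Set G} (hS : Subgroup.closure S = ⊤) (x y : G) :
    wordLength S (x * y) ≤ wordLength S x + wordLength S y := by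
  obtain ⟨l, hl, hlS, rfl⟩ := exists_list_length_eq_wordLength hS x
  obtain ⟨m, hm, hmS, rfl⟩ := exists_list_length_eq_wordLength hS y
  rw [← hl, ← hm, ← List.prod_append, ← List.length_append]
  exact wordLength_list_prod_le fun s hs ↦ (List.mem_append.1 hs).elim (hlS s) (hmS s)

/-- A homomorphism between finitely generated groups is Lipschitz for the word lengths. -/
lemma exists_wordLength_map_le {S : Set G} {T : Set K} (hSfin : S.Finite)
    (hS : Subgroup.closure S = ⊤) (hT : Subgroup.closure T = ⊤) (φ : G →* K) :
    ∃ L : ℕ, ∀ x, wordLength T (φ x) ≤ L * wordLength S x := by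
  obtain ⟨L, hL⟩ := ((hSfin.union hSfin.inv).image fun s ↦ wordLength T (φ s)).bddAbove
  refine ⟨L, fun x ↦ ?_⟩
  obtain ⟨l, hl, hlS, rfl⟩ := exists_list_length_eq_wordLength hS x
  rw [← hl]
  clear hl
  induction l with
  | nil => simpa using wordLength_list_prod_le (S := T) (l := []) (by simp)
  | cons s l ih =>
    have hs : wordLength T (φ s) ≤ L := hL ⟨s, hlS s (by simp), rfl⟩
    have hl := ih fun t ht ↦ hlS t (List.mem_cons_of_mem _ ht)
    have hmul := wordLength_mul_le hT (φ s) (φ l.prod)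
    rw [List.prod_cons, map_mul, List.length_cons, mul_add, mul_one]
    omega

/-- A finite-index subgroup is undistorted: an injective homomorphism with image of finite index
does not shrink word lengths by more than an affine amount. -/
lemma exists_wordLength_le_of_finiteIndex_range {S : Set Q} {T : Set P} (hSfin : S.Finite)
    (hS : Subgroup.closure S = ⊤) (hT : Subgroup.closure T = ⊤) (ψ : P →* Q)
    (hψ : Function.Injective ψ) [ψ.range.FiniteIndex] :
    ∃ L C : ℕ, ∀ x, wordLength T x ≤ L * wordLength S (ψ x) + C := by
  obtain ⟨R, hR, -⟩ := ψ.range.exists_isComplement_right 1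
  have hRfin : R.Finite := hR.finite_right_iff.2 inferInstance
  have hcov : ∀ y : Q, ∃ p : P, ∃ r ∈ R, ψ p * r = y := by
    intro y
    obtain ⟨⟨⟨_, p, rfl⟩, r⟩, h⟩ := hR.surjective y
    exact ⟨p, r, r.2, h⟩
  -- The elements of `P` that rewrite a product `r * s` as `p * r'`, for `r` and `r'` in the
  -- transversal and `s` a letter; by injectivity there are finitely many.
  have hA : {p : P | ψ p ∈ (fun a : (Q × Q) × Q ↦ a.1.1 * a.1.2 * a.2⁻¹) ''
      ((R ×ˢ (S ∪ S⁻¹)) ×ˢ R)}.Finite :=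
    ((((hRfin.prod (hSfin.union hSfin.inv)).prod hRfin).image _).preimage hψ.injOn)
  have hB : {p : P | ψ p ∈ R}.Finite := hRfin.preimage hψ.injOn
  obtain ⟨L, hL⟩ := (hA.image (wordLength T)).bddAbove
  obtain ⟨C, hC⟩ := (hB.image (wordLength T)).bddAbove
  obtain ⟨p₀, r₀, hr₀, h₀⟩ := hcov 1
  have key : ∀ l : List Q, (∀ s ∈ l, s ∈ S ∨ s⁻¹ ∈ S) →
      ∃ p : P, ∃ r ∈ R, ψ p * r = l.prod ∧ wordLength T p ≤ L * l.length + wordLength T p₀ := by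
    intro l
    induction l using List.reverseRecOn with
    | nil => exact fun _ ↦ ⟨p₀, r₀, hr₀, by simpa using h₀, by simp⟩
    | append_singleton l s ih =>
      intro hl
      obtain ⟨p, r, hr, hp, hlen⟩ := ih fun t ht ↦ hl t (by simp [ht])
      obtain ⟨p', r', hr', hp'⟩ := hcov (r * s)
      have hp'L : wordLength T p' ≤ L :=
        hL ⟨p', ⟨((r, s), r'), ⟨⟨hr, hl s (by simp)⟩, hr'⟩, by simp [← hp']⟩, rfl⟩
      refine ⟨p * p', r', hr', ?_, ?_⟩
      · rw [map_mul, mul_assoc, hp', ← mul_assoc, hp]; simp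
      · have hmul := wordLength_mul_le hT p p'
        rw [List.length_append, List.length_singleton, mul_add, mul_one]
        omega
  refine ⟨L, wordLength T p₀ + C, fun x ↦ ?_⟩
  obtain ⟨l, hl, hlS, hlx⟩ := exists_list_length_eq_wordLength hS (ψ x)
  obtain ⟨p, r, hr, hp, hlen⟩ := key l hlS
  have hpr : ψ (p⁻¹ * x) = r := by rw [map_mul, ← hlx, ← hp]; simp
  have hlast : wordLength T (p⁻¹ * x) ≤ C :=
    hC ⟨p⁻¹ * x, by rw [Set.mem_ofPred_eq, hpr]; exact hr, rfl⟩
  have hmul := wordLength_mul_le hT p (p⁻¹ * x)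
  rw [mul_inv_cancel_left] at hmul
  rw [← hl]
  omega

/-- A homomorphism `φ` is a quasi-isometric embedding as soon as some homomorphism `π` out of its
target makes `π ∘ φ` injective with image of finite index: then `φ` is bounded below because
`π ∘ φ` is bounded below and `π` is Lipschitz. -/
theorem isQuasiIsometricEmbedding_of_comp_injective_of_finiteIndex [Group.FG Q]
    (φ : P →* G) (π : G →* Q) (hinj : Function.Injective (π.comp φ))
    [(π.comp φ).range.FiniteIndex] {S : Set G} {T : Set P} (hSfin : S.Finite) (hTfin : T.Finite)
    (hS : Subgroup.closure S = ⊤) (hT : Subgroup.closure T = ⊤) :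
    IsQuasiIsometricEmbedding (wordDist T) (wordDist S) φ := by
  obtain ⟨U, hU, hUfin⟩ := Group.fg_iff.1 (inferInstance : Group.FG Q)
  obtain ⟨L₁, C, h₁⟩ := exists_wordLength_le_of_finiteIndex_range hUfin hU hT (π.comp φ) hinj
  obtain ⟨L₂, h₂⟩ := exists_wordLength_map_le hSfin hS hU π
  obtain ⟨L₃, h₃⟩ := exists_wordLength_map_le hTfin hT hS φ
  have hL : (1 : ℝ) ≤ L₁ * L₂ + L₃ + 1 := le_add_of_nonneg_left (by positivity)
  refine ⟨L₁ * L₂ + L₃ + 1, C, hL, by positivity, fun x y ↦ ?_⟩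
  unfold wordDist
  rw [← map_inv, ← map_mul]
  generalize x⁻¹ * y = z
  have hlow : (wordLength T z : ℝ) ≤ L₁ * L₂ * wordLength S (φ z) + C := by
    have h := (h₁ z).trans (Nat.add_le_add_right (Nat.mul_le_mul_left L₁ (h₂ (φ z))) C)
    rw [← mul_assoc] at h
    exact_mod_cast h
  have hup : (wordLength S (φ z) : ℝ) ≤ L₃ * wordLength T z := by exact_mod_cast h₃ z
  have hz : (0 : ℝ) ≤ wordLength T z := by positivity
  have hw : (0 : ℝ) ≤ wordLength S (φ z) := by positivity
  constructor
  · have hC : (C : ℝ) ≤ (L₁ * L₂ + L₃ + 1) * C := le_mul_of_one_le_left (by positivity) hL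
    rw [sub_le_iff_le_add, one_div, inv_mul_le_iff₀ (by linarith), mul_add]
    have hextra : (0 : ℝ) ≤ (L₃ + 1) * wordLength S (φ z) := by positivity
    linarith
  · have hextra : (0 : ℝ) ≤ (L₁ * L₂ + 1) * wordLength T z + C := by positivity
    linarith

end WordLength

/-! ### Finite generation of the fundamental group of a compact space -/

section FundamentalGroupFG

open Path.Homotopic (Quotient)

variable {X : Type*} [TopologicalSpace X]

lemma Path.Homotopic.Quotient.trans_symm_trans_cancel {x y z : X} (a : Path.Homotopic.Quotient x y)
    (b : Path.Homotopic.Quotient x z) : a.trans (a.symm.trans b) = b := by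
  rw [← trans_assoc, trans_symm, refl_trans]

lemma Path.Homotopic.Quotient.symm_trans_trans_cancel {x y z : X} (a : Path.Homotopic.Quotient x y)
    (b : Path.Homotopic.Quotient y z) : a.symm.trans (a.trans b) = b := by
  rw [← trans_assoc, symm_trans, refl_trans]

/-- Induction along a path that is cut into finitely many pieces, each inside one member of an open
cover. -/
lemma Path.induction_of_open_cover {ι : Type*} {V : ι → Set X} (hV : ∀ i, IsOpen (V i))
    (hcov : ⋃ i, V i = Set.univ) {x y : X} (γ : Path x y)
    (motive : ∀ z, Path.Homotopic.Quotient x z → Prop)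
    (refl : motive x (.refl x))
    (trans : ∀ (z w : X) (a : Path.Homotopic.Quotient x z) (ε : Path z w) (k : ι),
      Set.range ε ⊆ V k → motive z a → motive w (a.trans (.mk ε))) :
    motive y (.mk γ) := by
  obtain ⟨f, rfl, rfl⟩ := γ
  let γ : Path (f 0) (f 1) := ⟨f, rfl, rfl⟩
  obtain ⟨t, ht0, htmono, ⟨N, hN⟩, ht⟩ := exists_monotone_Icc_subset_open_cover_unitInterval
    (c := fun i ↦ f ⁻¹' V i) (fun i ↦ (hV i).preimage f.continuous)
    (by rw [← Set.preimage_iUnion, hcov, Set.preimage_univ])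
  have key : ∀ n, motive (f (t n)) (.mk (γ.subpath 0 (t n))) := by
    intro n
    induction n with
    | zero => rw [ht0, Path.subpath_self]; exact refl
    | succ n ih =>
      obtain ⟨k, hk⟩ := ht n
      have h := trans _ _ _ (γ.subpath (t n) (t (n + 1))) k
        (by rw [Path.range_subpath_of_le _ _ _ (htmono n.le_succ)]; exact Set.image_subset_iff.2 hk)
        ih
      rwa [← Path.Homotopic.Quotient.mk_trans, Path.Homotopic.Quotient.eq.2
        ⟨Path.Homotopy.subpathTransSubpath γ 0 (t n) (t (n + 1))⟩] at h
  have h1 := key N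
  rw [hN N le_rfl, Path.subpath_zero_one] at h1
  exact h1

/-- In a compact Hausdorff space covered by small path-connected sets `V i`, a loop is cut into
pieces lying in single sets `V i`; joining the division points to the centres of these sets writes
the loop as a product of finitely many elementary loops, which pass from a centre to the centre of
an intersecting set. Small means that the union of two intersecting sets contains at most one
homotopy class of paths between any two points. -/
theorem fundamentalGroup_fg_of_compactSpace [CompactSpace X] [T2Space X]
    [LocallyPathConnectedSpace X]
    (hX : ∀ x : X, ∃ U ∈ nhds x, ∀ (a b : X) (p p' : Path a b),
      Set.range p ⊆ U → Set.range p' ⊆ U → p.Homotopic p') (x₀ : X) :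
    Group.FG (FundamentalGroup X x₀) := by
  let _ := uniformSpaceOfCompactR1 (γ := X)
  choose U hU hUhom using hX
  obtain ⟨W, hW, hWU⟩ := lebesgue_number_lemma_nhds (U := U) isCompact_univ fun x _ ↦ hU x
  have hV : ∀ x : X, ∃ V : Set X, IsOpen V ∧ x ∈ V ∧ IsPathConnected V ∧ V ×ˢ V ⊆ W := by
    intro x
    obtain ⟨N, hN, hNW⟩ := (nhds_prod_eq (x := x) (y := x) ▸ nhds_le_uniformity x hW)
      |> Filter.mem_prod_same_iff.1
    obtain ⟨V, ⟨hVo, hxV, hVp⟩, hVN⟩ := (isOpen_isPathConnected_basis x).mem_iff.1 hN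
    exact ⟨V, hVo, hxV, hVp, (Set.prod_mono hVN hVN).trans hNW⟩
  choose V hVo hxV hVp hVW using hV
  obtain ⟨s, hs⟩ := isCompact_univ.elim_finite_subcover V hVo
    fun x _ ↦ Set.mem_iUnion.2 ⟨x, hxV x⟩
  have hcov : ⋃ i : s, V i = Set.univ := by
    rw [Set.eq_univ_iff_forall]
    intro x
    obtain ⟨i, hi, hx⟩ := Set.mem_iUnion₂.1 (hs (Set.mem_univ x))
    exact Set.mem_iUnion.2 ⟨⟨i, hi⟩, hx⟩
  have hunique : ∀ (i j z : X), z ∈ V i → z ∈ V j → ∀ (a b : X) (p p' : Path a b),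
      Set.range p ⊆ V i ∪ V j → Set.range p' ⊆ V i ∪ V j → p.Homotopic p' := by
    intro i j z hzi hzj a b p p' hp hp'
    obtain ⟨y, hy⟩ := hWU z (Set.mem_univ z)
    have hsub : V i ∪ V j ⊆ U y := by
      rintro w (hw | hw)
      · exact hy (hVW i ⟨hzi, hw⟩)
      · exact hy (hVW j ⟨hzj, hw⟩)
    exact hUhom y a b p p' (hp.trans hsub) (hp'.trans hsub)
  let c : ∀ i : X, Joined x₀ i → Quotient x₀ i := fun i hi ↦ .mk hi.somePath
  -- The elementary loops, and the loops that correct for `x₀` not being one of the centres.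
  let S₁ : s × s → Set (FundamentalGroup X x₀) := fun ij ↦
    {a | ∃ (hi : Joined x₀ ij.1) (hj : Joined x₀ ij.2) (γ : Path (ij.1 : X) ij.2),
      (V ij.1 ∩ V ij.2).Nonempty ∧ Set.range γ ⊆ V ij.1 ∪ V ij.2 ∧
      a = ((c _ hi).trans (.mk γ)).trans (c _ hj).symm}
  let S₂ : s → Set (FundamentalGroup X x₀) := fun i ↦
    {a | ∃ (hi : Joined x₀ i) (δ : Path x₀ (i : X)), Set.range δ ⊆ V i ∧
      a = Quotient.trans (.mk δ) (c _ hi).symm}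
  have hS₁ : ∀ ij, (S₁ ij).Finite := by
    refine fun ij ↦ Set.Subsingleton.finite ?_
    rintro _ ⟨hi, hj, γ, ⟨z, hz⟩, hγ, rfl⟩ _ ⟨_, _, γ', -, hγ', rfl⟩
    rw [Path.Homotopic.Quotient.eq.2 (hunique _ _ z hz.1 hz.2 _ _ γ γ' hγ hγ')]
  have hS₂ : ∀ i, (S₂ i).Finite := by
    refine fun i ↦ Set.Subsingleton.finite ?_
    rintro _ ⟨hi, δ, hδ, rfl⟩ _ ⟨_, δ', hδ', rfl⟩
    rw [Path.Homotopic.Quotient.eq.2 (hunique i i i (hxV i) (hxV i) _ _ δ δ'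
      (hδ.trans Set.subset_union_left) (hδ'.trans Set.subset_union_left))]
  refine Group.fg_iff.2 ⟨(⋃ ij, S₁ ij) ∪ ⋃ i, S₂ i, ?_,
    (Set.finite_iUnion hS₁).union (Set.finite_iUnion hS₂)⟩
  set K := Subgroup.closure ((⋃ ij, S₁ ij) ∪ ⋃ i, S₂ i)
  have hS₁K : ∀ ij, ∀ a ∈ S₁ ij, a ∈ K := fun ij a ha ↦
    Subgroup.subset_closure (Or.inl (Set.mem_iUnion.2 ⟨ij, ha⟩))
  have hS₂K : ∀ i, ∀ a ∈ S₂ i, a ∈ K := fun i a ha ↦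
    Subgroup.subset_closure (Or.inr (Set.mem_iUnion.2 ⟨i, ha⟩))
  rw [eq_top_iff]
  rintro a -
  induction a using Path.Homotopic.Quotient.ind with | _ γ
  -- A class `a` of paths from `x₀` to `z`, completed to a loop through a centre near `z`, lies
  -- in the subgroup generated by the elementary loops.
  let motive : ∀ z, Quotient x₀ z → Prop := fun z a ↦
    ∃ (i : s) (hi : Joined x₀ i) (δ : Path z (i : X)), Set.range δ ⊆ V i ∧
      ((a.trans (.mk δ)).trans (c _ hi).symm : FundamentalGroup X x₀) ∈ K
  have hpath : ∀ (z : X), ∀ k : s, z ∈ V k → ∃ δ : Path z (k : X), Set.range δ ⊆ V k := by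
    intro z k hz
    obtain ⟨δ, hδ⟩ := (hVp k).joinedIn z hz k (hxV k)
    exact ⟨δ, Set.range_subset_iff.2 hδ⟩
  have hγ : motive x₀ (.mk γ) := by
    refine Path.induction_of_open_cover (V := fun i : s ↦ V i) (fun i ↦ hVo i) hcov γ motive ?_ ?_
    · obtain ⟨i, hi⟩ := Set.mem_iUnion.1 (hcov ▸ Set.mem_univ x₀)
      obtain ⟨δ, hδ⟩ := hpath x₀ i hi
      refine ⟨i, ⟨δ⟩, δ, hδ, ?_⟩
      rw [Path.Homotopic.Quotient.refl_trans]
      exact hS₂K i _ ⟨⟨δ⟩, δ, hδ, rfl⟩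
    · rintro z w a ε k hε ⟨i, hi, δ, hδ, ha⟩
      have hzk : z ∈ V k := hε ⟨0, ε.source⟩
      have hzi : z ∈ V i := hδ ⟨0, δ.source⟩
      obtain ⟨δ', hδ'⟩ := hpath w k (hε ⟨1, ε.target⟩)
      let η : Path (i : X) k := δ.symm.trans (ε.trans δ')
      have hη : Set.range η ⊆ V i ∪ V k := by
        simp only [η, Path.trans_range, Path.symm_range]
        exact Set.union_subset_union hδ (Set.union_subset hε hδ')
      have hk : Joined x₀ k := hi.trans ⟨η⟩
      refine ⟨k, hk, δ', hδ', ?_⟩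
      -- A product in the fundamental group concatenates its factors from right to left.
      have h := K.mul_mem (hS₁K (i, k) _ ⟨hi, hk, η, ⟨z, hzi, hzk⟩, hη, rfl⟩) ha
      have heq : ((a.trans (.mk ε)).trans (.mk δ')).trans (c _ hk).symm =
          ((a.trans (.mk δ)).trans (c _ hi).symm).trans
            (((c _ hi).trans (.mk η)).trans (c _ hk).symm) := by
        simp only [η, Path.Homotopic.Quotient.mk_trans, Path.Homotopic.Quotient.mk_symm,
          Path.Homotopic.Quotient.trans_assoc,
          Path.Homotopic.Quotient.trans_symm_trans_cancel,
          Path.Homotopic.Quotient.symm_trans_trans_cancel]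
      rw [heq]
      exact h
  obtain ⟨i, hi, δ, hδ, h⟩ := hγ
  have h' := K.mul_mem (K.inv_mem (hS₂K i _ ⟨hi, δ, hδ, rfl⟩)) h
  have heq : Path.Homotopic.Quotient.mk γ = 
      (((Path.Homotopic.Quotient.mk γ).trans (.mk δ)).trans (c _ hi).symm).trans
        ((Path.Homotopic.Quotient.mk δ).trans (c _ hi).symm).symm := by
    rw [Path.Homotopic.Quotient.trans_assoc, Path.Homotopic.Quotient.trans_assoc,
      ← Path.Homotopic.Quotient.trans_assoc (.mk δ), Path.Homotopic.Quotient.trans_symm,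
      Path.Homotopic.Quotient.trans_refl]
  rw [heq]
  exact h'

end FundamentalGroupFG

/-! ### Local inversion on convex sets -/

section ConvexInversion

open Metric Filter Set
open scoped Topology NNReal

variable {E E' : Type*} [NormedAddCommGroup E] [NormedSpace ℝ E]
  [NormedAddCommGroup E'] [NormedSpace ℝ E']

lemma ContDiffWithinAt.exists_approximatesLinearOn {C : Set E} (hC : Convex ℝ C) {f : E → E'}
    {f' : E →L[ℝ] E'} {x : E} (hx : x ∈ C) (hu : UniqueDiffWithinAt ℝ C x)
    (hf : ContDiffWithinAt ℝ 1 f C x) (hf' : HasFDerivWithinAt f f' C x) {c : ℝ≥0} (hc : 0 < c) :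
    ∃ r > 0, ApproximatesLinearOn f f' (C ∩ ball x r) c := by
  rw [← zero_add (1 : WithTop ℕ∞),
    contDiffWithinAt_succ_iff_hasFDerivWithinAt' (by simp)] at hf
  obtain ⟨u, hu', -, -, g, hg, hgc⟩ := hf
  rw [insert_eq_of_mem hx] at hu'
  have hgx : g x = f' := hu.eq (hg x (mem_of_mem_nhdsWithin hx hu')) hf'
  have hclose : ∀ᶠ y in 𝓝[C] x, ‖g y - f'‖ ≤ c := by
    have h := hgc.continuousWithinAt.sub (continuousWithinAt_const (b := f'))
    have h0 := h.norm.tendsto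
    rw [Pi.sub_apply, hgx, sub_self, norm_zero] at h0
    exact (h0.eventually_lt_const (NNReal.coe_pos.2 hc)).mono fun y hy ↦ hy.le
  obtain ⟨r, hr, hball⟩ := mem_nhdsWithin_iff.1 (hclose.and hu')
  rw [inter_comm] at hball
  refine ⟨r, hr, fun y hy z hz ↦ ?_⟩
  exact (hC.inter (convex_ball x r)).norm_image_sub_le_of_norm_hasFDerivWithin_le'
    (fun w hw ↦ (hg w (hball hw).2).mono inter_subset_left) (fun w hw ↦ (hball hw).1) hz hy

/-- Let `f` be continuous and injective near the point `x` of the convex body `C`, open at the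
interior points of `C`, with values in the convex body `D`, and let it respect interior and
boundary points. Then `f`, as a map from `C` to `D`, is open at `x`.

A small ball around `f x` misses the image of a small sphere around `x`. Its intersection with the
interior of `D` is convex, hence connected, and the image of the ball around `x` is both open and
closed in it. -/
lemma nhdsWithin_le_map_of_convex [FiniteDimensional ℝ E] {C : Set E} {D : Set E'}
    (hC : Convex ℝ C) (hD : Convex ℝ D) (hCc : IsClosed C) (hCi : (interior C).Nonempty)
    (hDi : (interior D).Nonempty) {f : E → E'} {x : E} (hx : x ∈ C) {r : ℝ} (hr : 0 < r)
    (hcont : ContinuousOn f (C ∩ ball x r)) (hinj : InjOn f (C ∩ ball x r))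
    (hopen : ∀ y ∈ interior C ∩ ball x r, 𝓝 (f y) ≤ map f (𝓝 y))
    (hint : ∀ y ∈ C ∩ ball x r, (y ∈ interior C ↔ f y ∈ interior D)) :
    𝓝[D] (f x) ≤ map f (𝓝[C] x) := by
  intro t ht
  obtain ⟨r₁, hr₁, ht₁⟩ := mem_nhdsWithin_iff.1 (mem_map.1 ht)
  obtain ⟨r', hr', hlt⟩ := exists_between (lt_min hr hr₁)
  have hsub : closedBall x r' ⊆ ball x r := closedBall_subset_ball (hlt.trans_le (min_le_left _ _))
  have hsub₁ : closedBall x r' ⊆ ball x r₁ :=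
    closedBall_subset_ball (hlt.trans_le (min_le_right _ _))
  have : ProperSpace E := FiniteDimensional.proper ℝ E
  have hUc : IsClosed (f '' (C ∩ closedBall x r')) :=
    (((isCompact_closedBall x r').inter_left hCc).image_of_continuousOn
      (hcont.mono (inter_subset_inter_right C hsub))).isClosed
  have hSc : IsClosed (f '' (C ∩ sphere x r')) :=
    (((isCompact_sphere x r').inter_left hCc).image_of_continuousOn
      (hcont.mono (inter_subset_inter_right C (sphere_subset_closedBall.trans hsub)))).isClosed
  have hfx : f x ∉ f '' (C ∩ sphere x r') := by
    rintro ⟨y, ⟨hyC, hyS⟩, hyx⟩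
    have hyx' := hinj ⟨hyC, hsub (sphere_subset_closedBall hyS)⟩ ⟨hx, mem_ball_self hr⟩ hyx
    rw [hyx', mem_sphere, dist_self] at hyS
    exact hr'.ne hyS
  obtain ⟨ρ, hρ, hρS⟩ := Metric.isOpen_iff.1 hSc.isOpen_compl _ hfx
  set u := f '' (interior C ∩ ball x r')
  have huo : IsOpen u := by
    rw [isOpen_iff_mem_nhds]
    rintro _ ⟨y, hy, rfl⟩
    exact hopen y ⟨hy.1, hsub (ball_subset_closedBall hy.2)⟩
      (image_mem_map ((isOpen_interior.inter isOpen_ball).mem_nhds hy))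
  have huU : u ⊆ f '' (C ∩ closedBall x r') :=
    image_mono (inter_subset_inter interior_subset ball_subset_closedBall)
  have hsubset : ball (f x) ρ ∩ interior D ⊆ u := by
    refine ((convex_ball (f x) ρ).inter hD.interior).isPreconnected.subset_of_closure_inter_subset
      huo ?_ ?_
    · have hne : (𝓝[interior C] x).NeBot := by
        rw [← mem_closure_iff_nhdsWithin_neBot,
          hC.closure_interior_eq_closure_of_nonempty_interior hCi]
        exact subset_closure hx
      have hcx : Tendsto f (𝓝[interior C] x) (𝓝 (f x)) := by
        have h := (hcont x ⟨hx, mem_ball_self hr⟩).mono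
          (inter_subset_inter_left (ball x r) interior_subset)
        rwa [ContinuousWithinAt, nhdsWithin_inter_of_mem'
          (mem_nhdsWithin_of_mem_nhds (ball_mem_nhds x hr))] at h
      obtain ⟨z, ⟨hzρ, hzC⟩, hzr⟩ := (((hcx.eventually (ball_mem_nhds (f x) hρ)).and
        (self_mem_nhdsWithin : interior C ∈ _)).and
          (mem_nhdsWithin_of_mem_nhds (ball_mem_nhds x hr'))).exists
      exact ⟨f z, ⟨hzρ, (hint z ⟨interior_subset hzC,
        hsub (ball_subset_closedBall hzr)⟩).1 hzC⟩, z, ⟨hzC, hzr⟩, rfl⟩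
    · rintro y ⟨hyu, hyρ, hyD⟩
      obtain ⟨z, ⟨hzC, hzr⟩, rfl⟩ := closure_minimal huU hUc hyu
      refine ⟨z, ⟨(hint z ⟨hzC, hsub hzr⟩).2 hyD, ?_⟩, rfl⟩
      refine lt_of_le_of_ne hzr fun hzS ↦ hρS hyρ ⟨z, ⟨hzC, hzS⟩, rfl⟩
  have hball : ball (f x) ρ ∩ D ⊆ f '' (C ∩ closedBall x r') := by
    rintro y ⟨hyρ, hyD⟩
    refine closure_minimal (hsubset.trans huU) hUc (isOpen_ball.inter_closure ⟨hyρ, ?_⟩)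
    rw [hD.closure_interior_eq_closure_of_nonempty_interior hDi]
    exact subset_closure hyD
  refine mem_of_superset (mem_nhdsWithin_iff.2 ⟨ρ, hρ, hball⟩) ?_
  rintro _ ⟨z, ⟨hzC, hzr⟩, rfl⟩
  exact ht₁ ⟨hsub₁ hzr, hzC⟩

/-- The inverse function theorem for a map between convex bodies that respects interior and
boundary points. -/
theorem ContDiffWithinAt.exists_injOn_and_nhdsWithin_le_map [FiniteDimensional ℝ E]
    {C : Set E} {D : Set E'}
    (hC : Convex ℝ C) (hD : Convex ℝ D) (hCc : IsClosed C) (hCi : (interior C).Nonempty)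
    (hDi : (interior D).Nonempty) {f : E → E'} {f' : E ≃L[ℝ] E'} {x : E} (hx : x ∈ C)
    (hf : ContDiffWithinAt ℝ 1 f C x) (hf' : HasFDerivWithinAt f (f' : E →L[ℝ] E') C x)
    (hint : ∀ᶠ y in 𝓝[C] x, (y ∈ interior C ↔ f y ∈ interior D)) :
    (∃ U ∈ 𝓝[C] x, InjOn f U) ∧ 𝓝[D] (f x) ≤ map f (𝓝[C] x) := by
  have hu : UniqueDiffWithinAt ℝ C x := uniqueDiffOn_convex hC hCi x hx
  -- The smallness of `c` that makes an approximation of `f'` within `c` injective and open.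
  obtain ⟨c, hc0, hc⟩ : ∃ c : ℝ≥0, 0 < c ∧
      (Subsingleton E ∨ c < ‖(f'.symm : E' →L[ℝ] E)‖₊⁻¹) := by
    rcases f'.subsingleton_or_nnnorm_symm_pos with h | h
    · exact ⟨1, one_pos, Or.inl h⟩
    · obtain ⟨c, hc0, hc⟩ := exists_between (inv_pos.2 h)
      exact ⟨c, hc0, Or.inr hc⟩
  obtain ⟨r₁, hr₁, happrox⟩ := hf.exists_approximatesLinearOn hC hx hu hf' hc0
  obtain ⟨r₂, hr₂, hint₂⟩ := mem_nhdsWithin_iff.1 hint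
  set r := min r₁ r₂
  have hr : 0 < r := lt_min hr₁ hr₂
  have happ : ApproximatesLinearOn f (f' : E →L[ℝ] E') (C ∩ ball x r) c :=
    happrox.mono_set (inter_subset_inter_right C (ball_subset_ball (min_le_left _ _)))
  have hinj : InjOn f (C ∩ ball x r) := happ.injOn hc
  have : CompleteSpace E := FiniteDimensional.complete ℝ E
  refine ⟨⟨C ∩ ball x r, inter_mem_nhdsWithin C (ball_mem_nhds x hr), hinj⟩,
    nhdsWithin_le_map_of_convex hC hD hCc hCi hDi hx hr happ.continuousOn hinj (fun y hy ↦ ?_)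
      fun y hy ↦ hint₂ ⟨ball_subset_ball (min_le_right _ _) hy.2, hy.1⟩⟩
  refine (happ.map_nhds_eq f'.toNonlinearRightInverse ?_ ?_).ge
  · exact mem_of_superset ((isOpen_interior.inter isOpen_ball).mem_nhds hy)
      (inter_subset_inter_left _ interior_subset)
  · exact hc.imp (fun (_ : Subsingleton E) ↦ f'.symm.injective.subsingleton) id

end ConvexInversion

/-! ### Maps with bijective derivative between compact manifolds with boundary -/

section LocalHomeomorph

open Filter Set
open scoped Topology

variable {E E' H H' M N : Type*} [NormedAddCommGroup E] [NormedSpace ℝ E]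
  [NormedAddCommGroup E'] [NormedSpace ℝ E']
  [TopologicalSpace H] [TopologicalSpace H']
  {I : ModelWithCorners ℝ E H} {I' : ModelWithCorners ℝ E' H'}
  [TopologicalSpace M] [ChartedSpace H M] [TopologicalSpace N] [ChartedSpace H' N]

lemma isInteriorPoint_iff_extChartAt_mem_interior_range [IsManifold I 1 M] {x y : M}
    (hy : y ∈ (extChartAt I x).source) :
    I.IsInteriorPoint y ↔ extChartAt I x y ∈ interior (range I) := by
  rw [I.isInteriorPoint_iff_of_mem_atlas one_ne_zero (chart_mem_atlas H x)
    (extChartAt_source I x ▸ hy)]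
  refine ⟨fun h ↦ OpenPartialHomeomorph.interior_extend_target_subset_interior_range _ h,
    fun h ↦ ?_⟩
  refine OpenPartialHomeomorph.mem_interior_extend_target (f := chartAt H x) ?_ h
  exact (chartAt H x).map_source (extChartAt_source I x ▸ hy)

/-- A `C¹` map with bijective derivatives that maps interior points to interior points and boundary
points to boundary points is a local homeomorphism. -/
theorem isLocalHomeomorph_of_bijective_mfderiv [FiniteDimensional ℝ E] [IsManifold I 1 M]
    [IsManifold I' 1 N] {q : M → N}
    (hq : ContMDiff I I' 1 q) (hbij : ∀ x, Function.Bijective (mfderiv I I' q x))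
    (hint : ∀ x, I.IsInteriorPoint x ↔ I'.IsInteriorPoint (q x)) : IsLocalHomeomorph q := by
  have key : ∀ x, (∃ U ∈ 𝓝 x, InjOn q U) ∧ 𝓝 (q x) ≤ map q (𝓝 x) := by
    intro x
    let φ := extChartAt I x
    let ψ := extChartAt I' (q x)
    let f : E → E' := writtenInExtChartAt I I' x q
    have hfx : f (φ x) = ψ (q x) := by simp [f, φ, ψ]
    have hmd : MDifferentiableAt I I' q x := (hq x).mdifferentiableAt one_ne_zero
    let d : E →L[ℝ] E' := mfderiv I I' q x
    let f' : E ≃L[ℝ] E' := (LinearEquiv.ofBijective d.toLinearMap (hbij x)).toContinuousLinearEquiv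
    have hf' : HasFDerivWithinAt f (f' : E →L[ℝ] E') (range I) (φ x) := by
      have hd : (f' : E →L[ℝ] E') = d := by ext; rfl
      rw [hd]
      exact hmd.hasMFDerivAt.2
    have hf : ContDiffWithinAt ℝ 1 f (range I) (φ x) := (contMDiffAt_iff.1 (hq x)).2
    have hφ : ∀ᶠ y in 𝓝[range I] (φ x), y ∈ φ.target ∧ q (φ.symm y) ∈ ψ.source := by
      refine Filter.Eventually.and (extChartAt_target_mem_nhdsWithin x) ?_
      have h : ∀ᶠ z in map φ.symm (𝓝[range I] (φ x)), q z ∈ ψ.source := by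
        rw [map_extChartAt_symm_nhdsWithin_range]
        exact hq.continuous.continuousAt (extChartAt_source_mem_nhds (q x))
      exact h
    have hfint : ∀ᶠ y in 𝓝[range I] (φ x),
        (y ∈ interior (range I) ↔ f y ∈ interior (range I')) := by
      filter_upwards [hφ] with y ⟨hy, hqy⟩
      have h := hint (φ.symm y)
      rw [isInteriorPoint_iff_extChartAt_mem_interior_range (φ.map_target hy),
        isInteriorPoint_iff_extChartAt_mem_interior_range hqy] at h
      rwa [show extChartAt I x (φ.symm y) = y from φ.right_inv hy] at h
    obtain ⟨⟨U, hU, hUinj⟩, hopen⟩ := hf.exists_injOn_and_nhdsWithin_le_map I.convex_range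
      I'.convex_range I.isClosed_range I.nonempty_interior I'.nonempty_interior
      (extChartAt_target_subset_range x (mem_extChartAt_target x)) hf' hfint
    constructor
    · refine ⟨φ.source ∩ q ⁻¹' ψ.source ∩ φ ⁻¹' U, inter_mem (inter_mem
        (extChartAt_source_mem_nhds x)
        (hq.continuous.continuousAt (extChartAt_source_mem_nhds (q x)))) ?_, ?_⟩
      · rw [← mem_map, map_extChartAt_nhds]; exact hU
      · rintro y ⟨⟨hy, hqy⟩, hyU⟩ z ⟨⟨hz, hqz⟩, hzU⟩ hyz
        refine φ.injOn hy hz (hUinj hyU hzU ?_)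
        simp only [f, writtenInExtChartAt, Function.comp_apply, φ] at hy hz ⊢
        rw [(extChartAt I x).left_inv hy, (extChartAt I x).left_inv hz, hyz]
    · rw [hfx] at hopen
      have hcongr : ∀ᶠ y in 𝓝[range I] (φ x), (ψ.symm ∘ f) y = (q ∘ φ.symm) y := by
        filter_upwards [hφ] with y ⟨hy, hqy⟩
        exact ψ.left_inv hqy
      calc 𝓝 (q x) = map ψ.symm (𝓝[range I'] (ψ (q x))) :=
            (map_extChartAt_symm_nhdsWithin_range (q x)).symm
        _ ≤ map ψ.symm (map f (𝓝[range I] (φ x))) := map_mono hopen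
        _ = map q (map φ.symm (𝓝[range I] (φ x))) := by
            rw [map_map, map_map, map_congr hcongr]
        _ = map q (𝓝 x) := by rw [map_extChartAt_symm_nhdsWithin_range]
  have hopenmap : IsOpenMap q := isOpenMap_iff_nhds_le.2 fun x ↦ (key x).2
  refine isLocalHomeomorph_iff_isOpenEmbedding_restrict.2 fun x ↦ ?_
  obtain ⟨U, hU, hUinj⟩ := (key x).1
  obtain ⟨V, hVU, hV, hxV⟩ := mem_nhds_iff.1 hU
  exact ⟨V, hV.mem_nhds hxV, .of_continuous_injective_isOpenMap
    (hq.continuous.comp continuous_subtype_val) (injOn_iff_injective.1 (hUinj.mono hVU))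
    (hopenmap.domRestrict hV)⟩

end LocalHomeomorph

/-! ### Small sets in a manifold -/

section SemilocallySimplyConnected

open Set
open scoped Topology

variable {E H M : Type*} [NormedAddCommGroup E] [NormedSpace ℝ E] [TopologicalSpace H]
  [TopologicalSpace M] [ChartedSpace H M]

/-- The part of a chart domain that corresponds to a ball in the model space is convex in the
chart, so paths in it with the same endpoints are joined by the straight-line homotopy. -/
lemma exists_nhds_forall_path_homotopic (I : ModelWithCorners ℝ E H) (x : M) :
    ∃ U ∈ 𝓝 x, ∀ (a b : M) (p p' : Path a b), range p ⊆ U → range p' ⊆ U → p.Homotopic p' := by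
  let φ := extChartAt I x
  obtain ⟨r, hr, hball⟩ := Metric.mem_nhdsWithin_iff.1 (extChartAt_target_mem_nhdsWithin (I := I) x)
  refine ⟨φ.source ∩ φ ⁻¹' Metric.ball (φ x) r, Filter.inter_mem (extChartAt_source_mem_nhds x)
    (continuousAt_extChartAt x (Metric.ball_mem_nhds _ hr)), fun a b p p' hp hp' ↦ ?_⟩
  have hconv : Convex ℝ (Metric.ball (φ x) r ∩ range I) := (convex_ball _ _).inter I.convex_range
  have hmem : ∀ y ∈ φ.source ∩ φ ⁻¹' Metric.ball (φ x) r, φ y ∈ Metric.ball (φ x) r ∩ range I :=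
    fun y hy ↦ ⟨hy.2, extChartAt_target_subset_range x (φ.map_source hy.1)⟩
  have hps : ∀ t, p t ∈ φ.source ∩ φ ⁻¹' Metric.ball (φ x) r := fun t ↦ hp ⟨t, rfl⟩
  have hps' : ∀ t, p' t ∈ φ.source ∩ φ ⁻¹' Metric.ball (φ x) r := fun t ↦ hp' ⟨t, rfl⟩
  have hc : Continuous fun t ↦ φ (p t) := (continuousOn_extChartAt x).comp_continuous
    p.continuous fun t ↦ (hps t).1
  have hc' : Continuous fun t ↦ φ (p' t) := (continuousOn_extChartAt x).comp_continuous
    p'.continuous fun t ↦ (hps' t).1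
  let h : unitInterval × unitInterval → E := fun z ↦
    (1 - (z.1 : ℝ)) • φ (p z.2) + (z.1 : ℝ) • φ (p' z.2)
  have hh : Continuous h :=
    ((continuous_const.sub (continuous_subtype_val.comp continuous_fst)).smul
      (hc.comp continuous_snd)).add
        ((continuous_subtype_val.comp continuous_fst).smul (hc'.comp continuous_snd))
  have hht : ∀ z, h z ∈ φ.target := fun z ↦ hball (hconv (hmem _ (hps z.2)) (hmem _ (hps' z.2))
    (sub_nonneg.2 z.1.2.2) z.1.2.1 (sub_add_cancel _ _))
  refine ⟨⟨⟨⟨fun z ↦ φ.symm (h z), (continuousOn_extChartAt_symm x).comp_continuous hh hht⟩,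
    fun t ↦ ?_, fun t ↦ ?_⟩, fun s t ht ↦ ?_⟩⟩
  · simp [h, φ.left_inv (hps t).1]
  · simp [h, φ.left_inv (hps' t).1]
  · have heq : p t = p' t := by rcases ht with rfl | rfl <;> simp
    have hht' : h (s, t) = φ (p t) := by
      simp only [h]
      rw [← heq, ← add_smul, sub_add_cancel, one_smul]
    change φ.symm (h (s, t)) = p t
    rw [hht', φ.left_inv (hps t).1]

end SemilocallySimplyConnected

/-! ### Finite coverings and fundamental groups -/

section Covering

variable {X Y : Type*} [TopologicalSpace X] [TopologicalSpace Y]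

lemma IsCoveringMap.finite_fiber [CompactSpace X] [T1Space Y] {p : X → Y} (hp : IsCoveringMap p)
    (y : Y) : Finite (p ⁻¹' {y}) := by
  have : DiscreteTopology (p ⁻¹' {y}) := (hp y).discreteTopology_fiber
  have : CompactSpace (p ⁻¹' {y}) :=
    isCompact_iff_compactSpace.1 (isClosed_singleton.preimage hp.continuous).isCompact
  exact finite_of_compact_of_discrete

lemma IsCoveringMap.injective_fundamentalGroup_map {p : C(X, Y)} (hp : IsCoveringMap p) (x : X) :
    Function.Injective (FundamentalGroup.map p x) :=
  hp.injective_path_homotopic_map x x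

/-- The image of the fundamental group of a covering space contains the stabilizer of the base
point under monodromy, which has finite index if the fibre is finite. -/
lemma IsCoveringMap.finiteIndex_range_fundamentalGroup_map {p : C(X, Y)} (hp : IsCoveringMap p)
    (x : X) [Finite (p ⁻¹' {p x})] : (FundamentalGroup.map p x).range.FiniteIndex := by
  let _ := hp.fundamentalGroupMulAction (p x)
  let e : p ⁻¹' {p x} := ⟨x, rfl⟩
  have hstab : (MulAction.stabilizer (FundamentalGroup Y (p x)) e).FiniteIndex := by
    refine ⟨?_⟩
    rw [MulAction.index_stabilizer]
    exact (Set.ncard_pos (Set.toFinite _)).2 (MulAction.nonempty_orbit e) |>.ne'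
  refine Subgroup.finiteIndex_of_le
    (H := MulAction.stabilizer (FundamentalGroup Y (p x)) e) fun γ hγ ↦ ?_
  have hγe : hp.monodromy γ e = e := hγ
  have hend : (x : X) = (hp.monodromy γ e : X) := congrArg Subtype.val hγe.symm
  refine ⟨(hp.liftPathQuotient γ e).cast rfl hend, ?_⟩
  change Path.Homotopic.Quotient.map _ p = γ
  rw [Path.Homotopic.Quotient.map_cast,
    show (hp.liftPathQuotient γ e).map p = _ from hp.map_liftPathQuotient γ e]
  exact (Path.Homotopic.Quotient.cast_cast ..).trans (Path.Homotopic.Quotient.cast_rfl_rfl _)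

end Covering

/-! ### Horizontal surfaces -/

section HorizontalSurface

variable {F B : Type*} [TopologicalSpace F] [ChartedSpace (EuclideanHalfSpace 2) F]
  [TopologicalSpace B] [ChartedSpace (EuclideanHalfSpace 2) B]

lemma IsHorizontalSurface.contMDiff_fst {g : C(B, F × Circle)} (hg : IsHorizontalSurface g) :
    ContMDiff (𝓡∂ 2) (𝓡∂ 2) ∞ fun b ↦ (g b).1 :=
  _root_.contMDiff_fst.comp hg.smooth

/-- Projecting to the base kills the fibre direction, so transversality makes the derivative of the
projection surjective; it is bijective since both surfaces have dimension two. -/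
lemma IsHorizontalSurface.bijective_mfderiv_fst {g : C(B, F × Circle)} (hg : IsHorizontalSurface g)
    (b : B) : Function.Bijective (mfderiv (𝓡∂ 2) (𝓡∂ 2) (fun b ↦ (g b).1) b) := by
  let J := (𝓡∂ 2).prod (𝓡 1)
  have hgd : MDifferentiableAt (𝓡∂ 2) J g b := hg.smooth.mdifferentiable (by simp) b
  have hcomp : mfderiv (𝓡∂ 2) (𝓡∂ 2) (fun b ↦ (g b).1) b =
      (ContinuousLinearMap.fst ℝ (TangentSpace (𝓡∂ 2) (g b).1) (TangentSpace (𝓡 1) (g b).2)).comp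
        (mfderiv (𝓡∂ 2) J g b) := by
    rw [← mfderiv_fst (I := 𝓡∂ 2) (I' := 𝓡 1) (x := g b)]
    exact mfderiv_comp b mdifferentiableAt_fst hgd
  have hfibre : ∀ v ∈ fibreTangent (g b), v.1 = 0 := by
    rintro _ ⟨w, rfl⟩
    -- The projection to the base is constant on the fibre.
    have h := mfderiv_comp (I := 𝓡 1) (I' := J) (I'' := 𝓡∂ 2) (g b).2
      (g := Prod.fst) (f := fun θ : Circle ↦ ((g b).1, θ)) mdifferentiableAt_fst
      (mdifferentiableAt_const.prodMk mdifferentiableAt_id)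
    have hconst : mfderiv (𝓡 1) (𝓡∂ 2) (Prod.fst ∘ fun θ : Circle ↦ ((g b).1, θ)) (g b).2 = 0 :=
      mfderiv_const
    rw [hconst, mfderiv_fst] at h
    exact (congrArg (fun L ↦ L w) h).symm
  have hsurj : Function.Surjective (mfderiv (𝓡∂ 2) (𝓡∂ 2) (fun b ↦ (g b).1) b) := by
    intro v
    let v' : TangentSpace J (g b) := (v, 0)
    have hv : v' ∈ LinearMap.range (mfderiv (𝓡∂ 2) J g b).toLinearMap ⊔ fibreTangent (g b) := by
      rw [hg.transverse b]
      exact Submodule.mem_top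
    obtain ⟨_, ⟨u, rfl⟩, w, hw, huw⟩ := Submodule.mem_sup.1 hv
    refine ⟨u, ?_⟩
    rw [hcomp]
    have h : (mfderiv (𝓡∂ 2) J g b u).1 + w.1 = v := congrArg Prod.fst huw
    rwa [hfibre w hw, add_zero] at h
  let d : EuclideanSpace ℝ (Fin 2) →ₗ[ℝ] EuclideanSpace ℝ (Fin 2) :=
    (mfderiv (𝓡∂ 2) (𝓡∂ 2) (fun b ↦ (g b).1) b).toLinearMap
  exact ⟨LinearMap.injective_iff_surjective (f := d).2 hsurj, hsurj⟩

lemma IsHorizontalSurface.isInteriorPoint_iff [IsManifold (𝓡∂ 2) ∞ F] [IsManifold (𝓡∂ 2) ∞ B]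
    {g : C(B, F × Circle)} (hg : IsHorizontalSurface g) (b : B) :
    (𝓡∂ 2).IsInteriorPoint b ↔ (𝓡∂ 2).IsInteriorPoint (g b).1 := by
  constructor
  · exact (hg.contMDiff_fst.mdifferentiable (by simp) b).isInteriorPoint_of_surjective_mfderiv
      (hg.bijective_mfderiv_fst b).2
  · contrapose
    intro h
    rw [← ModelWithCorners.isBoundaryPoint_iff_not_isInteriorPoint] at h ⊢
    have hgb : g b ∈ ((𝓡∂ 2).prod (𝓡 1)).boundary (F × Circle) :=
      (hg.proper.ge ⟨b, h, rfl⟩).2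
    rw [ModelWithCorners.boundary_of_boundaryless_right] at hgb
    exact hgb.1

variable [IsManifold (𝓡∂ 2) ∞ F] [IsManifold (𝓡∂ 2) ∞ B]

/-- A compact horizontal surface is a finite covering of the base surface. -/
theorem IsHorizontalSurface.isCoveringMap_fst [T2Space F] [T2Space B] [CompactSpace B]
    {g : C(B, F × Circle)} (hg : IsHorizontalSurface g) :
    IsCoveringMap (ContinuousMap.fst.comp g) := by
  have : IsManifold (𝓡∂ 2) 1 F := IsManifold.of_le (n := ∞) (by simp)
  have : IsManifold (𝓡∂ 2) 1 B := IsManifold.of_le (n := ∞) (by simp)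
  exact isLocalHomeomorph_iff_isCoveringMap.1 <| isLocalHomeomorph_of_bijective_mfderiv
    (hg.contMDiff_fst.of_le (by simp)) hg.bijective_mfderiv_fst hg.isInteriorPoint_iff

end HorizontalSurface

lemma fundamentalGroup_fg_of_compact_manifold {E H M : Type*} [NormedAddCommGroup E]
    [NormedSpace ℝ E] [TopologicalSpace H] (I : ModelWithCorners ℝ E H) [TopologicalSpace M]
    [ChartedSpace H M] [LocallyPathConnectedSpace M] [CompactSpace M] [T2Space M] (x : M) :
    Group.FG (FundamentalGroup M x) :=
  fundamentalGroup_fg_of_compactSpace (exists_nhds_forall_path_homotopic I) x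

theorem mainTheorem4 {F B : Type*}
    [TopologicalSpace F] [ChartedSpace (EuclideanHalfSpace 2) F] [IsManifold (𝓡∂ 2) ∞ F]
    [T2Space F] [CompactSpace F] [ConnectedSpace F]
    [TopologicalSpace B] [ChartedSpace (EuclideanHalfSpace 2) B] [IsManifold (𝓡∂ 2) ∞ B]
    [T2Space B] [CompactSpace B]
    (hFboundary : ((𝓡∂ 2).boundary F).Nonempty)
    (hFchi : eulerCharacteristic F < 0)
    (g : C(B, F × Circle)) (hg : IsHorizontalSurface g) (b : B) :
    Group.FG (FundamentalGroup B b) ∧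
    Group.FG (FundamentalGroup (F × Circle) (g b)) ∧
    ∀ S : Finset (FundamentalGroup (F × Circle) (g b)),
      Subgroup.closure (S : Set (FundamentalGroup (F × Circle) (g b))) = ⊤ →
      (∀ T : Finset (FundamentalGroup B b),
        Subgroup.closure (T : Set (FundamentalGroup B b)) = ⊤ →
        IsQuasiIsometricEmbedding (wordDist (T : Set (FundamentalGroup B b)))
          (wordDist (S : Set (FundamentalGroup (F × Circle) (g b))))
          (FundamentalGroup.map g b)) ∧
      (∀ T : Finset (FundamentalGroup.map g b).range,
        Subgroup.closure (T : Set (FundamentalGroup.map g b).range) = ⊤ →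
        IsQuasiIsometricEmbedding (wordDist (T : Set (FundamentalGroup.map g b).range))
          (wordDist (S : Set (FundamentalGroup (F × Circle) (g b))))
          (FundamentalGroup.map g b).range.subtype) := by
  have : LocallyPathConnectedSpace B :=
    ChartedSpace.locallyPathConnectedSpace (EuclideanHalfSpace 2) B
  have : LocallyPathConnectedSpace F :=
    ChartedSpace.locallyPathConnectedSpace (EuclideanHalfSpace 2) F
  have : LocallyPathConnectedSpace Circle :=
    ChartedSpace.locallyPathConnectedSpace (EuclideanSpace ℝ (Fin 1)) Circle
  have : Group.FG (FundamentalGroup F (g b).1) := fundamentalGroup_fg_of_compact_manifold (𝓡∂ 2) _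
  refine ⟨fundamentalGroup_fg_of_compact_manifold (𝓡∂ 2) b,
    fundamentalGroup_fg_of_compact_manifold ((𝓡∂ 2).prod (𝓡 1)) (g b), fun S hS ↦ ?_⟩
  let φ := FundamentalGroup.map g b
  let π : FundamentalGroup (F × Circle) (g b) →* FundamentalGroup F (g b).1 :=
    FundamentalGroup.map ContinuousMap.fst (g b)
  have hcov := hg.isCoveringMap_fst
  have hcomp : π.comp φ = FundamentalGroup.map (ContinuousMap.fst.comp g) b := by
    ext γ
    exact Path.Homotopic.Quotient.map_comp.symm
  have hfin := hcov.finite_fiber ((ContinuousMap.fst.comp g) b)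
  have hinj : Function.Injective (π.comp φ) :=
    hcomp ▸ hcov.injective_fundamentalGroup_map b
  have hidx : (π.comp φ).range.FiniteIndex :=
    hcomp ▸ hcov.finiteIndex_range_fundamentalGroup_map b
  refine ⟨fun T hT ↦ isQuasiIsometricEmbedding_of_comp_injective_of_finiteIndex φ π hinj
    S.finite_toSet T.finite_toSet hS hT, fun T hT ↦ ?_⟩
  have hinj' : Function.Injective (π.comp φ.range.subtype) := by
    rintro ⟨_, x, rfl⟩ ⟨_, y, rfl⟩ hxy
    exact Subtype.ext (congrArg φ (hinj hxy))
  have hidx' : (π.comp φ.range.subtype).range.FiniteIndex := by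
    rwa [MonoidHom.range_comp, Subgroup.range_subtype, ← MonoidHom.range_comp]
  exact isQuasiIsometricEmbedding_of_comp_injective_of_finiteIndex φ.range.subtype π hinj'
    S.finite_toSet T.finite_toSet hS hT
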